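/- Let $k$ be a number field with ring of integers $\mathfrak{o}$. For an infinite place $\nu$ of $k$ write $\|x\|_\nu=|x|_\nu^{d_\nu}$, where $|\cdot|_\nu$ extends the usual absolute value and $d_\nu=1$ or $2$ according as $\nu$ is real or complex. Fix integral ideals $\mathfrak{a}_1,\dots,\mathfrak{a}_h$ of $\mathfrak{o}$, one from each ideal class, and let $Z_3'$ be the set of $\mathbf{y}\in\mathfrak{o}^3$ such that the ideal $\langle y_1,y_2,y_3\rangle$ generated by the coordinates is one of the $\mathfrak{a}_j$. For a vector $\mathbf{r}=(r_\nu)_{\nu\mid\infty}$ of real numbers $r_\nu\ge 1$, put $\|\mathbf{r}\|=\prod_{\nu\mid\infty}r_\nu$ and $L(\mathbf{r})=\{x\in\mathfrak{o}: \|x\|_\nu\le r_\nu \text{ for all } \nu\mid\infty\}$. For a $3\times 3$ matrix $\mathbf{M}$ over $\mathfrak{o}$, let $\Delta(\mathbf{M})$ be the ideal generated by $\det\mathbf{M}$ and $\Delta_0(\mathbf{M})$ the ideal generated by the $2\times 2$ minors of $\mathbf{M}$. Let $\mathrm{N}_k$ denote the ideal norm, and let $\tau(\mathfrak{b})$ be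 the number of integral ideals dividing $\mathfrak{b}$. Then there is a constant $C>0$, depending only on $k$ and the fixed ideals $\mathfrak{a}_1,\dots,\mathfrak{a}_h$, such that the following holds. Let $Q(\mathbf{x})=\mathbf{x}^T\mathbf{M}\mathbf{x}$ be a non-singular ternary quadratic form, where $\mathbf{M}$ is a symmetric $3\times 3$ matrix with entries in $\mathfrak{o}$ and $\det\mathbf{M}\neq 0$, and let $\mathbf{r}_1,\mathbf{r}_2,\mathbf{r}_3$ be vectors of real numbers $\ge 1$ indexed by the infinite places of $k$. Then the number of points $x\in\mathbb{P}^2(k)$ that have homogeneous coordinates $x=[y_1,y_2,y_3]$ with $\mathbf{y}\in Z_3'$, $Q(\mathbf{y})=0$ and $y_i\in L(\mathbf{r}_i)$ for $i=1,2,3$ is finite and at most $$ C\left(1+\left(\frac{\|\mathbf{r}_1\|\,\|\mathbf{r}_2\|\,\|\mathbf{r}_3\|\;\mathrm{N}_k(\Delta_0(\mathbf{M}))^{3/2}}{\mathrm{N}_k(\Delta(\mathbf{M}))}\right)^{1/3}\right)\tau(\Delta(\mathbf{M})). $$ -/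

import Mathlib

open NumberField
open scoped nonZeroDivisors LinearAlgebra.Projectivization

namespace ConicCount

noncomputable section

/-- The ternary quadratic form `Q(x) = xᵀ M x` over `k`, for a matrix `M` with entries in the ring
of integers. When `M` is symmetric, it is the underlying matrix of `Q`, and `Q` is non-singular
exactly when `det M ≠ 0`. -/
def form {k : Type*} [Field k] (M : Matrix (Fin 3) (Fin 3) (𝓞 k)) :
    QuadraticForm k (Fin 3 → k) :=
  (M.map (algebraMap (𝓞 k) k)).toQuadraticForm'

/-- The ideal `Δ(M)` generated by the determinant. -/
def detIdeal {k : Type*} [Field k] (M : Matrix (Fin 3) (Fin 3) (𝓞 k)) : Ideal (𝓞 k) :=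
  Ideal.span {M.det}

/-- The ideal `Δ₀(M)` generated by the nine `2 × 2` minors. -/
def minorIdeal {k : Type*} [Field k] (M : Matrix (Fin 3) (Fin 3) (𝓞 k)) : Ideal (𝓞 k) :=
  Ideal.span {a | ∃ f g : Fin 2 ↪o Fin 3, a = (M.submatrix f g).det}

/-- The divisor function on integral ideals: the number of ideals dividing `I`. -/
def tau {k : Type*} [Field k] (I : Ideal (𝓞 k)) : ℕ :=
  Set.ncard {J : Ideal (𝓞 k) | J ∣ I}

/-- The box `L(r)`: the integers `x` of `k` with `‖x‖_ν = |x|_ν ^ d_ν ≤ r_ν` for every infinite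
place `ν`, where `d_ν` is `1` if `ν` is real and `2` if `ν` is complex. -/
def box {k : Type*} [Field k] (r : InfinitePlace k → ℝ) : Set (𝓞 k) :=
  {x | ∀ v : InfinitePlace k, v (x : k) ^ v.mult ≤ r v}

/-- `‖r‖`, the product of the components of `r`. -/
def boxNorm {k : Type*} [Field k] [NumberField k] (r : InfinitePlace k → ℝ) : ℝ :=
  ∏ v : InfinitePlace k, r v

/-- `a` picks one (non-zero) integral ideal in each ideal class. -/
def IsClassRepresentatives {k : Type*} [Field k] [NumberField k]
    (a : ClassGroup (𝓞 k) → (Ideal (𝓞 k))⁰) : Prop :=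
  ∀ c, ClassGroup.mk0 (a c) = c

/-- The set `Z'₃` of integral vectors whose coordinates generate one of the chosen ideals. -/
def primitiveVectors {k : Type*} [Field k] [NumberField k]
    (a : ClassGroup (𝓞 k) → (Ideal (𝓞 k))⁰) : Set (Fin 3 → 𝓞 k) :=
  {y | ∃ c, Ideal.span (Set.range y) = (a c : Ideal (𝓞 k))}

/-- The points `x ∈ ℙ²(k)` on the conic `Q = 0` which have homogeneous coordinates
`y = (y₁, y₂, y₃) ∈ Z'₃` with `yᵢ ∈ L(rᵢ)` for `i = 1, 2, 3`. -/
def conicPoints {k : Type*} [Field k] [NumberField k]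
    (a : ClassGroup (𝓞 k) → (Ideal (𝓞 k))⁰) (M : Matrix (Fin 3) (Fin 3) (𝓞 k))
    (r : Fin 3 → InfinitePlace k → ℝ) : Set (ℙ k (Fin 3 → k)) :=
  {x | ∃ (y : Fin 3 → 𝓞 k) (hy : (fun i => (y i : k)) ≠ 0),
    Projectivization.mk k (fun i => (y i : k)) hy = x ∧
    form M (fun i => (y i : k)) = 0 ∧
    y ∈ primitiveVectors a ∧ ∀ i, y i ∈ box (r i)}

end

end ConicCount

/-! Write B for `pairing` and T for `triple`. For isotropic u, v, w the Gram determinant gives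
T(u,v,w)² det M = 2 B(u,v) B(u,w) B(v,w). Distinct points of the conic have B ≠ 0
(`proportional_of_pairing_eq_zero`), so any three have T ≠ 0. The box bounds N(T) from above; the
count follows once any three points with the same label are shown to have T too divisible.

At a prime p let δ be the exponent of the ideal of minors and f = ord det M - δ. Take a pair a, b of
the family with ord B(a,b) minimal. The label of a point x is ord B(a,x) truncated at f, so it takes
at most f + 1 values, and equal labels force ord B(x,y) ≥ f - ord 2 (`exists_local_classes`). As f ≤
ord det M, the labels at all primes together form a divisor of det M, whence the factor τ.

Fix a prime P dividing none of the chosen ideals, so that all the vectors are primitive at P. There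
the ratio T(a,b,x)/B(a,x), which parametrises the pencil of lines through a, is also recorded,
suitably normalised, modulo Pⁿ; one bit says whether to project from b instead. Equal labels then
gain 2n in ord B(x,y) (`exists_refined_classes`).

Three points with one common label would give (det M)² P^(6n) ∣ T² Δ₀³ (2)². Taking norms
contradicts the box bound as soon as N(P)^(3n) exceeds a constant times the quantity under the cube
root. For such an n each label has at most two points, and there are at most τ · 2 N(P)ⁿ labels
(`card_le_of_not_dvd`). The least such n costs only a cube root. -/

namespace ConicCount

open Matrix

/-! ### Gram identities for isotropic vectors -/

section Algebra

variable {R : Type*} [CommRing R]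

/-- The bilinear form `uᵀ M v`. -/
def pairing (M : Matrix (Fin 3) (Fin 3) R) (u v : Fin 3 → R) : R := u ⬝ᵥ (M *ᵥ v)

/-- The determinant of three vectors. -/
def triple (u v w : Fin 3 → R) : R := (Matrix.of ![u, v, w]).det

lemma pairing_comm {M : Matrix (Fin 3) (Fin 3) R} (hM : M.IsSymm) (u v : Fin 3 → R) :
    pairing M u v = pairing M v u := by
  unfold pairing
  rw [dotProduct_mulVec, dotProduct_comm, ← mulVec_transpose, hM.eq]

lemma mixed_gram (M : Matrix (Fin 3) (Fin 3) R) (u v w u' v' w' : Fin 3 → R) :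
    Matrix.of ![u, v, w] * M * (Matrix.of ![u', v', w'])ᵀ =
      !![pairing M u u', pairing M u v', pairing M u w';
         pairing M v u', pairing M v v', pairing M v w';
         pairing M w u', pairing M w v', pairing M w w'] := by
  ext i j
  rw [Matrix.mul_assoc]
  fin_cases i <;> fin_cases j <;> rfl

lemma triple_mul_det_mul_triple (M : Matrix (Fin 3) (Fin 3) R) (u v w u' v' w' : Fin 3 → R) :
    triple u v w * M.det * triple u' v' w' =
      (!![pairing M u u', pairing M u v', pairing M u w';
         pairing M v u', pairing M v v', pairing M v w';
         pairing M w u', pairing M w v', pairing M w w']).det := by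
  rw [← mixed_gram, det_mul, det_mul, det_transpose]; rfl

/-- The Gram determinant of three isotropic vectors. -/
lemma triple_sq_mul_det {M : Matrix (Fin 3) (Fin 3) R} (hM : M.IsSymm) {u v w : Fin 3 → R}
    (hu : pairing M u u = 0) (hv : pairing M v v = 0) (hw : pairing M w w = 0) :
    triple u v w ^ 2 * M.det = 2 * pairing M u v * pairing M u w * pairing M v w := by
  have h := triple_mul_det_mul_triple M u v w u v w
  conv_rhs at h => rw [det_fin_three]
  simp [hu, hv, hw, pairing_comm hM v u, pairing_comm hM w u, pairing_comm hM w v] at h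
  linear_combination h

lemma triple_mul_det_mul_triple_of_isotropic {M : Matrix (Fin 3) (Fin 3) R} (hM : M.IsSymm)
    {u v w w' : Fin 3 → R} (hu : pairing M u u = 0) (hv : pairing M v v = 0) :
    triple u v w * M.det * triple u v w' = pairing M u v *
      (pairing M u w * pairing M v w' + pairing M u w' * pairing M v w
        - pairing M u v * pairing M w w') := by
  have h := triple_mul_det_mul_triple M u v w u v w'
  conv_rhs at h => rw [det_fin_three]
  simp [hu, hv, pairing_comm hM v u, pairing_comm hM w u, pairing_comm hM w v] at h
  linear_combination h

/-- The adjugate reverses products, and the outer factors cancel against `Aᵀ` and `A`, each leaving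
`A.det`. -/
lemma adjugate_identity (M : Matrix (Fin 3) (Fin 3) R) (A : Matrix (Fin 3) (Fin 3) R) :
    A.det ^ 2 • M.adjugate = Aᵀ * (A * M * Aᵀ).adjugate * A := by
  rw [adjugate_mul_distrib, adjugate_mul_distrib]
  have h1 : Aᵀ * (Aᵀ).adjugate = A.det • (1 : Matrix (Fin 3) (Fin 3) R) := by
    rw [mul_adjugate, det_transpose]
  calc _ = (Aᵀ * (Aᵀ).adjugate) * M.adjugate * (A.adjugate * A) := by
        rw [h1, adjugate_mul]; simp [smul_smul, sq]
    _ = _ := by simp only [Matrix.mul_assoc]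

/-- This is `adjugate_identity` for the matrix with rows u, v, w, whose Gram matrix has zero
diagonal. It is how the minors of M enter the local estimates. -/
lemma adjugate_gram {M : Matrix (Fin 3) (Fin 3) R} (hM : M.IsSymm) {u v w : Fin 3 → R}
    (hu : pairing M u u = 0) (hv : pairing M v v = 0) (hw : pairing M w w = 0) (i j : Fin 3) :
    triple u v w ^ 2 * M.adjugate i j =
      - pairing M v w ^ 2 * (u i * u j) - pairing M u w ^ 2 * (v i * v j)
      - pairing M u v ^ 2 * (w i * w j)
      + pairing M u w * pairing M v w * (u i * v j + v i * u j)
      + pairing M u v * pairing M v w * (u i * w j + w i * u j)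
      + pairing M u v * pairing M u w * (v i * w j + w i * v j) := by
  have h := congrFun (congrFun (adjugate_identity M (Matrix.of ![u, v, w])) i) j
  rw [mixed_gram, adjugate_fin_three_of] at h
  simp only [Matrix.smul_apply, smul_eq_mul, Matrix.mul_apply, Fin.sum_univ_three] at h
  simp [hu, hv, hw, pairing_comm hM v u, pairing_comm hM w u, pairing_comm hM w v] at h
  unfold triple
  rw [h]; ring

/-- Four vectors in 3-space satisfy Cramer's linear relation; the functional B(u,·) is applied to
it, and the term with B(u,u) drops out. -/
lemma cramer_relation {M : Matrix (Fin 3) (Fin 3) R} {u v w w' : Fin 3 → R}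
    (hu : pairing M u u = 0) :
    pairing M u w * triple u v w' - pairing M u w' * triple u v w =
      pairing M u v * triple u w w' := by
  have h : pairing M u u * triple v w w' = 0 := by rw [hu, zero_mul]
  revert h
  simp only [pairing, dotProduct_mulVec]
  generalize (u ᵥ* M) = a
  simp only [triple, dotProduct, Fin.sum_univ_three, det_fin_three, of_apply, cons_val',
    cons_val_zero, cons_val_one, cons_val]
  intro h
  linear_combination -h

@[simp] lemma triple_left (u v : Fin 3 → R) : triple u v u = 0 :=
  det_zero_of_row_eq (i := 0) (j := 2) (by decide) rfl

@[simp] lemma triple_right (u v : Fin 3 → R) : triple u v v = 0 :=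
  det_zero_of_row_eq (i := 1) (j := 2) (by decide) rfl

/-- Orthogonal isotropic vectors of a non-singular ternary form are proportional. -/
lemma proportional_of_pairing_eq_zero [IsDomain R] {M : Matrix (Fin 3) (Fin 3) R} (hM : M.IsSymm)
    (hdet : M.det ≠ 0) {u v : Fin 3 → R} (hu : pairing M u u = 0) (hv : pairing M v v = 0)
    (h : pairing M u v = 0) (i j : Fin 3) : u i * v j = u j * v i := by
  -- The product formula with w = w' carries a factor B(u,v). Evaluating T(u,v,·) at the basis
  -- vectors then gives u × v = 0.
  have key : ∀ w, triple u v w = 0 := fun w ↦ by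
    have := triple_mul_det_mul_triple_of_isotropic hM (w := w) (w' := w) hu hv
    rw [h, zero_mul] at this
    simpa [hdet] using this
  have h0 := key ![1, 0, 0]
  have h1 := key ![0, 1, 0]
  have h2 := key ![0, 0, 1]
  simp [triple, det_fin_three] at h0 h1 h2
  fin_cases i <;> fin_cases j <;> simp
  · linear_combination h2
  · linear_combination -h1
  · linear_combination -h2
  · linear_combination h0
  · linear_combination h1
  · linear_combination -h0

/-- The ideal generated by the `2 × 2` minors is generated by the entries of the adjugate. -/
lemma span_minors_le_iff (M : Matrix (Fin 3) (Fin 3) R) (I : Ideal R) :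
    Ideal.span {a | ∃ f g : Fin 2 ↪o Fin 3, a = (M.submatrix f g).det} ≤ I ↔
      ∀ i j, M.adjugate i j ∈ I := by
  rw [Ideal.span_le]
  constructor
  · intro h i j
    have := h ⟨Fin.succAboveOrderEmb j, Fin.succAboveOrderEmb i, rfl⟩
    rw [adjugate_fin_succ_eq_det_submatrix]
    exact I.mul_mem_left _ this
  · rintro h _ ⟨f, g, rfl⟩
    have cover : ∀ f : Fin 2 ↪o Fin 3, ∃ i : Fin 3, f = Fin.succAboveOrderEmb i := by
      intro f
      have h01 : f 0 < f 1 := f.strictMono (by decide)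
      have aux : ∀ a b : Fin 3, a < b → ∃ i : Fin 3, a = i.succAbove 0 ∧ b = i.succAbove 1 := by
        decide
      obtain ⟨i, ha, hb⟩ := aux _ _ h01
      refine ⟨i, ?_⟩
      ext x
      fin_cases x
      · exact congrArg Fin.val ha
      · exact congrArg Fin.val hb
    obtain ⟨j, rfl⟩ := cover f
    obtain ⟨i, rfl⟩ := cover g
    have := h i j
    rw [adjugate_fin_succ_eq_det_submatrix] at this
    have h2 := I.mul_mem_left ((-1) ^ (j + i : ℕ)) this
    rw [← mul_assoc, ← pow_add, ← two_mul, pow_mul] at h2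
    have h3 : (M.submatrix j.succAbove i.succAbove).det ∈ I := by simpa using h2
    exact h3

lemma span_ne_zero {x : R} (hx : x ≠ 0) : Ideal.span {x} ≠ 0 := by simpa using hx

lemma mul_mem_pow_add {I : Ideal R} {x y : R} {m n : ℕ} (hx : x ∈ I ^ m) (hy : y ∈ I ^ n) :
    x * y ∈ I ^ (m + n) := by
  rw [pow_add]; exact Ideal.mul_mem_mul hx hy

lemma sq_mem_pow {I : Ideal R} {x : R} {m : ℕ} (hx : x ∈ I ^ m) : x ^ 2 ∈ I ^ (2 * m) := by
  rw [sq, two_mul]; exact mul_mem_pow_add hx hx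

end Algebra

/-! ### Exponents of primes in a Dedekind domain -/

section Order

open UniqueFactorizationMonoid

open scoped Classical in
/-- The exponent of `p` in the factorisation of the ideal `I`. -/
noncomputable def ord {R : Type*} [CommRing R] [IsDedekindDomain R] (p I : Ideal R) : ℕ :=
  Multiset.count p (normalizedFactors I)

variable {R : Type*} [CommRing R] [IsDedekindDomain R] {p : Ideal R}

/-- The exponent of `p` in the factorisation of `(x)`. -/
noncomputable abbrev eord (p : Ideal R) (x : R) : ℕ := ord p (Ideal.span {x})

lemma le_ord_iff (hp : Prime p) {I : Ideal R} (hI : I ≠ 0) {n : ℕ} : n ≤ ord p I ↔ I ≤ p ^ n := by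
  classical
  rw [← Ideal.dvd_iff_le, pow_dvd_iff_le_emultiplicity,
    emultiplicity_eq_count_normalizedFactors hp.irreducible hI, normalize_eq, Nat.cast_le, ord]

lemma ord_mul {I J : Ideal R} (hI : I ≠ 0) (hJ : J ≠ 0) : ord p (I * J) = ord p I + ord p J := by
  simp [ord, normalizedFactors_mul hI hJ]

lemma ord_pow {I : Ideal R} (n : ℕ) : ord p (I ^ n) = n * ord p I := by
  simp [ord, normalizedFactors_pow]

open scoped Classical in
lemma ord_prime {q : Ideal R} (hq : Prime q) :
    ord p q = if p = q then 1 else 0 := by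
  unfold ord
  rw [normalizedFactors_irreducible hq.irreducible, normalize_eq, Multiset.count_singleton]

lemma dvd_of_forall_ord_le {I J : Ideal R} (hI : I ≠ 0) (hJ : J ≠ 0)
    (h : ∀ p, Prime p → ord p I ≤ ord p J) : I ∣ J := by
  classical
  rw [dvd_iff_normalizedFactors_le_normalizedFactors hI hJ, Multiset.le_iff_count]
  intro p
  by_cases hp : p ∈ normalizedFactors I
  · simpa only [ord] using h p (prime_of_normalized_factor p hp)
  · rw [Multiset.count_eq_zero_of_notMem hp]; exact Nat.zero_le _

lemma mem_pow_iff (hp : Prime p) {x : R} (hx : x ≠ 0) {n : ℕ} : x ∈ p ^ n ↔ n ≤ eord p x := by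
  rw [le_ord_iff hp (span_ne_zero hx), Ideal.span_singleton_le_iff_mem]

lemma eord_mul {x y : R} (hx : x ≠ 0) (hy : y ≠ 0) : eord p (x * y) = eord p x + eord p y := by
  rw [eord, ← Ideal.span_singleton_mul_span_singleton,
    ord_mul (span_ne_zero hx) (span_ne_zero hy)]

lemma eord_pow {x : R} (n : ℕ) : eord p (x ^ n) = n * eord p x := by
  rw [eord, ← Ideal.span_singleton_pow, ord_pow]

lemma eord_mem (hp : Prime p) (x : R) : x ∈ p ^ eord p x := by
  by_cases hx : x = 0
  · simp [hx]
  · exact (mem_pow_iff hp hx).2 le_rfl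

lemma eord_eq (hp : Prime p) {x : R} {n : ℕ} (h : x ∈ p ^ n) (h' : x ∉ p ^ (n + 1)) :
    eord p x = n := by
  have hx : x ≠ 0 := by rintro rfl; simp at h'
  rw [mem_pow_iff hp hx] at h h'
  omega

lemma mem_pow_of_sq_mem (hp : Prime p) {x : R} {m n : ℕ} (hx : x ^ 2 ∈ p ^ m) (h : 2 * n ≤ m + 1) :
    x ∈ p ^ n := by
  by_cases h0 : x = 0
  · simp [h0]
  rw [mem_pow_iff hp (pow_ne_zero 2 h0), eord_pow] at hx
  rw [mem_pow_iff hp h0]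
  omega

lemma mem_pow_of_mul_mem (hp : Prime p) {a x : R} {m n : ℕ} (ha : a ≠ 0)
    (h : a * x ∈ p ^ m) (hm : n + eord p a ≤ m) : x ∈ p ^ n := by
  by_cases h0 : x = 0
  · simp [h0]
  rw [mem_pow_iff hp (mul_ne_zero ha h0), eord_mul ha h0] at h
  rw [mem_pow_iff hp h0]
  omega

/-- Division by `a` modulo a power of `p`. -/
lemma exists_sub_mul_mem (hp : Prime p) {a x : R} {m : ℕ} (n : ℕ) (ha : a ≠ 0)
    (hm : eord p a = m) (hx : x ∈ p ^ m) : ∃ s, x - a * s ∈ p ^ (m + n) := by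
  have hpz : p ^ (m + n) ≠ 0 := pow_ne_zero _ hp.ne_zero
  have : p ^ m ≤ Ideal.span {a} ⊔ p ^ (m + n) := by
    have hne : Ideal.span {a} ⊔ p ^ (m + n) ≠ 0 := by
      intro h
      apply hpz
      rw [Ideal.zero_eq_bot] at *
      exact (sup_eq_bot_iff.1 h).2
    rw [← Ideal.dvd_iff_le]
    apply dvd_of_forall_ord_le hne (pow_ne_zero _ hp.ne_zero)
    intro q hq
    classical
    have h1 : ord q (Ideal.span {a} ⊔ p ^ (m + n)) ≤ ord q (p ^ (m + n)) := by
      rw [le_ord_iff hq hpz]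
      exact le_sup_right.trans ((le_ord_iff hq hne).1 le_rfl)
    have h2 : ord q (Ideal.span {a} ⊔ p ^ (m + n)) ≤ eord q a := by
      rw [eord, le_ord_iff hq (span_ne_zero ha)]
      exact le_sup_left.trans ((le_ord_iff hq hne).1 le_rfl)
    rw [ord_pow, ord_prime hp] at h1 ⊢
    split_ifs at * with h
    · subst h; omega
    · omega
  obtain ⟨b, hb, c, hc, rfl⟩ := Submodule.mem_sup.1 (this hx)
  obtain ⟨s, rfl⟩ := Ideal.mem_span_singleton'.1 hb
  exact ⟨s, by convert hc using 1; ring⟩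

end Order

/-- The ideal generated by the `2 × 2` minors, over any commutative ring. -/
def minors {R : Type*} [CommRing R] (M : Matrix (Fin 3) (Fin 3) R) : Ideal R :=
  Ideal.span {a | ∃ f g : Fin 2 ↪o Fin 3, a = (M.submatrix f g).det}

lemma minors_ne_zero {R : Type*} [CommRing R] {M : Matrix (Fin 3) (Fin 3) R}
    (hdet : M.det ≠ 0) : minors M ≠ 0 := by
  intro h
  have hadj := (span_minors_le_iff M ⊥).1 (le_of_eq h)
  have h0 : M.adjugate = 0 := by
    ext i j
    exact (Submodule.mem_bot R).1 (hadj i j)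
  have h1 := congrFun (congrFun (mul_adjugate M) 0) 0
  rw [h0] at h1
  simp at h1
  exact hdet h1.symm

/-! ### Estimates at one prime -/

section Local

variable {R : Type*} [CommRing R] [IsDedekindDomain R] {p : Ideal R}
  {M : Matrix (Fin 3) (Fin 3) R}

lemma adjugate_mem (hp : Prime p) (hdet : M.det ≠ 0) (i j : Fin 3) :
    M.adjugate i j ∈ p ^ ord p (minors M) :=
  (span_minors_le_iff M _).1 ((le_ord_iff hp (minors_ne_zero hdet)).1 le_rfl) i j

lemma exists_adjugate_notMem (hp : Prime p) (hdet : M.det ≠ 0) :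
    ∃ i j, M.adjugate i j ∉ p ^ (ord p (minors M) + 1) := by
  by_contra! h
  have := (span_minors_le_iff M _).2 h
  have := (le_ord_iff hp (minors_ne_zero hdet)).2 this
  omega

lemma ord_minors_le (hp : Prime p) (hdet : M.det ≠ 0) : ord p (minors M) ≤ eord p M.det := by
  rw [← mem_pow_iff hp hdet]
  have h1 := congrFun (congrFun (mul_adjugate M) 0) 0
  simp only [Matrix.smul_apply, one_apply_eq, smul_eq_mul, mul_one] at h1
  rw [← h1, mul_apply]
  exact Ideal.sum_mem _ fun j _ ↦ Ideal.mul_mem_left _ _ (adjugate_mem hp hdet _ _)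

/-- With b = ord B(u,v), T(u,v,w)² det M and T(u,v,w')² det M lie in p^(2b+f), hence so does their
geometric mean T(u,v,w) det M T(u,v,w'). In the expansion of the latter every term but B(u,v)²
B(w,w') visibly lies there. Vanishing of B(u,w) or B(u,w') is allowed. -/
lemma pairing_mem_of_both_mem (hM : M.IsSymm) (hp : Prime p) {u v w w' : Fin 3 → R} {f : ℕ}
    (hu : pairing M u u = 0) (hv : pairing M v v = 0) (hw : pairing M w w = 0)
    (hw' : pairing M w' w' = 0) (huv : pairing M u v ≠ 0)
    (huw : pairing M u w ∈ p ^ f) (huw' : pairing M u w' ∈ p ^ f)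
    (hvw : pairing M v w ∈ p ^ eord p (pairing M u v))
    (hvw' : pairing M v w' ∈ p ^ eord p (pairing M u v)) :
    pairing M w w' ∈ p ^ f := by
  set b := eord p (pairing M u v) with hb
  have huvb : pairing M u v ∈ p ^ b := eord_mem hp _
  have hT : ∀ {x}, pairing M x x = 0 → pairing M u x ∈ p ^ f → pairing M v x ∈ p ^ b →
      triple u v x ^ 2 * M.det ∈ p ^ (2 * b + f) := by
    intro x hx h h'
    rw [triple_sq_mul_det hM hu hv hx]
    have := Ideal.mul_mem_left _ 2 (mul_mem_pow_add (mul_mem_pow_add huvb h) h')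
    rw [show b + f + b = 2 * b + f by ring] at this
    convert this using 1
    ring
  have hTT : triple u v w * M.det * triple u v w' ∈ p ^ (2 * b + f) := by
    refine mem_pow_of_sq_mem hp (m := (2 * b + f) + (2 * b + f)) ?_ (by omega)
    convert mul_mem_pow_add (hT hw huw hvw) (hT hw' huw' hvw') using 1
    ring
  have hkey := triple_mul_det_mul_triple_of_isotropic hM (w := w) (w' := w') hu hv
  have hmem : pairing M u v * pairing M u v * pairing M w w' ∈ p ^ (2 * b + f) := by
    have e : pairing M u v * pairing M u v * pairing M w w' =
        pairing M u v * (pairing M u w * pairing M v w') +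
        pairing M u v * (pairing M u w' * pairing M v w) -
        triple u v w * M.det * triple u v w' := by rw [hkey]; ring
    rw [e]
    refine sub_mem (add_mem ?_ ?_) hTT <;> rw [show 2 * b + f = b + (f + b) by ring]
    · exact mul_mem_pow_add huvb (mul_mem_pow_add huw hvw')
    · exact mul_mem_pow_add huvb (mul_mem_pow_add huw' hvw)
  refine mem_pow_of_mul_mem hp (mul_ne_zero huv huv) hmem ?_
  rw [eord_mul huv huv]
  omega

lemma triple_ne_zero (h2 : (2 : R) ≠ 0) (hM : M.IsSymm) {u v w : Fin 3 → R}
    (hu : pairing M u u = 0) (hv : pairing M v v = 0) (hw : pairing M w w = 0)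
    (huv : pairing M u v ≠ 0) (huw : pairing M u w ≠ 0) (hvw : pairing M v w ≠ 0) :
    triple u v w ≠ 0 := by
  intro h
  have := triple_sq_mul_det hM hu hv hw
  rw [h] at this
  simp [h2, huv, huw, hvw] at this

variable (h2 : (2 : R) ≠ 0) (hM : M.IsSymm) (hdet : M.det ≠ 0)

include h2 hM hdet

lemma two_mul_eord_triple {u v w : Fin 3 → R}
    (hu : pairing M u u = 0) (hv : pairing M v v = 0) (hw : pairing M w w = 0)
    (huv : pairing M u v ≠ 0) (huw : pairing M u w ≠ 0) (hvw : pairing M v w ≠ 0) :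
    2 * eord p (triple u v w) + eord p M.det =
      eord p 2 + eord p (pairing M u v) + eord p (pairing M u w) + eord p (pairing M v w) := by
  have h := congrArg (eord p) (triple_sq_mul_det hM hu hv hw)
  rw [eord_mul (pow_ne_zero _ (triple_ne_zero h2 hM hu hv hw huv huw hvw)) hdet, eord_pow,
    eord_mul (by simp [h2, huv, huw]) hvw, eord_mul (by simp [h2, huv]) huw, eord_mul h2 huv] at h
  exact h

variable (hp : Prime p)

include hp

/-- Every term on the right of `adjugate_gram` is quadratic in the pairings, so p^(2t) divides T²
times an adjugate entry whose exponent is exactly that of the minors. -/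
lemma two_mul_le_of_pairing_mem {u v w : Fin 3 → R}
    (hu : pairing M u u = 0) (hv : pairing M v v = 0) (hw : pairing M w w = 0)
    (huv : pairing M u v ≠ 0) (huw : pairing M u w ≠ 0) (hvw : pairing M v w ≠ 0) {t : ℕ}
    (huv' : pairing M u v ∈ p ^ t) (huw' : pairing M u w ∈ p ^ t) (hvw' : pairing M v w ∈ p ^ t) :
    2 * t ≤ 2 * eord p (triple u v w) + ord p (minors M) := by
  obtain ⟨i, j, hij⟩ := exists_adjugate_notMem hp hdet
  have hne : M.adjugate i j ≠ 0 := by intro h; simp [h] at hij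
  have hT := triple_ne_zero h2 hM hu hv hw huv huw hvw
  rw [mem_pow_iff hp hne] at hij
  have hmem : triple u v w ^ 2 * M.adjugate i j ∈ p ^ (2 * t) := by
    rw [adjugate_gram hM hu hv hw]
    have hsq : ∀ {a b c : R}, a ∈ p ^ t → b ∈ p ^ t → a * b * c ∈ p ^ (2 * t) := by
      intro a b c ha hb
      rw [two_mul]
      exact Ideal.mul_mem_right _ _ (mul_mem_pow_add ha hb)
    simp only [sq]
    refine add_mem (add_mem (add_mem (sub_mem (sub_mem ?_ ?_) ?_) ?_) ?_) ?_
    · rw [neg_mul, neg_mem_iff]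
      exact hsq hvw' hvw'
    all_goals exact hsq ‹_› ‹_›
  rw [mem_pow_iff hp (mul_ne_zero (pow_ne_zero 2 hT) hne), eord_mul (pow_ne_zero 2 hT) hne,
    eord_pow] at hmem
  omega

/-- An upper bound for the exponents of `p` in the pairings of isotropic vectors, when the first pairing is strictly the least divisible
one and the opposite vector is primitive at `p`. -/
lemma three_point_reverse {u v w : Fin 3 → R}
    (hu : pairing M u u = 0) (hv : pairing M v v = 0) (hw : pairing M w w = 0)
    (huv : pairing M u v ≠ 0) (huw : pairing M u w ≠ 0) (hvw : pairing M v w ≠ 0)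
    (huw' : pairing M u w ∈ p ^ (eord p (pairing M u v) + 1))
    (hvw' : pairing M v w ∈ p ^ (eord p (pairing M u v) + 1))
    (hprim : ∃ i, w i ∉ p) :
    eord p 2 + eord p (pairing M u w) + eord p (pairing M v w) + ord p (minors M) ≤
      eord p M.det + eord p (pairing M u v) := by
  obtain ⟨i, hi⟩ := hprim
  set b := eord p (pairing M u v) with hb
  have hwi : w i ≠ 0 := by intro h; simp [h] at hi
  have hT := triple_ne_zero h2 hM hu hv hw huv huw hvw
  have h3 := two_mul_eord_triple (p := p) h2 hM hdet hu hv hw huv huw hvw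
  by_contra! hlt
  have hmem : triple u v w ^ 2 * M.adjugate i i ∈ p ^ (2 * b + 1) := by
    refine Ideal.pow_le_pow_right ?_
      (mul_mem_pow_add (sq_mem_pow (eord_mem hp (triple u v w))) (adjugate_mem hp hdet i i))
    omega
  have hmul : ∀ {a c d : R}, a ∈ p ^ b → c ∈ p ^ (b + 1) → a * c * d ∈ p ^ (2 * b + 1) := by
    intro a c d ha hc
    have := Ideal.mul_mem_right d _ (mul_mem_pow_add ha hc)
    rwa [show b + (b + 1) = 2 * b + 1 by ring] at this
  have hle : p ^ (b + 1) ≤ p ^ b := Ideal.pow_le_pow_right (by omega)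
  have huvb : pairing M u v ∈ p ^ b := eord_mem hp _
  -- If the bound failed, all other terms of the diagonal `adjugate_gram` would lie in p^(2b+1). As
  -- B(u,v)² has exponent exactly 2b, this puts w i in p.
  have hmain : pairing M u v ^ 2 * (w i * w i) ∈ p ^ (2 * b + 1) := by
    have h := adjugate_gram hM hu hv hw i i
    have e : pairing M u v ^ 2 * (w i * w i) = - (triple u v w ^ 2 * M.adjugate i i)
        - pairing M v w * pairing M v w * (u i * u i) - pairing M u w * pairing M u w * (v i * v i)
        + pairing M u w * pairing M v w * (u i * v i + v i * u i)
        + pairing M u v * pairing M v w * (u i * w i + w i * u i)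
        + pairing M u v * pairing M u w * (v i * w i + w i * v i) := by
      rw [h]; ring
    rw [e]
    refine add_mem (add_mem (add_mem (sub_mem (sub_mem (neg_mem hmem) ?_) ?_) ?_) ?_) ?_
    · exact hmul (hle hvw') hvw'
    · exact hmul (hle huw') huw'
    · exact hmul (hle huw') hvw'
    · exact hmul huvb hvw'
    · exact hmul huvb huw'
  have hne : w i * w i ≠ 0 := mul_ne_zero hwi hwi
  rw [mem_pow_iff hp (mul_ne_zero (pow_ne_zero 2 huv) hne), eord_mul (pow_ne_zero 2 huv) hne,
    eord_pow, eord_mul hwi hwi] at hmain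
  rw [← pow_one p, mem_pow_iff hp hwi] at hi
  omega

/-- The comparison of two isotropic vectors `w`, `w'` by means of a reference pair `u`, `v`. -/
lemma le_eord_pairing {u v w w' : Fin 3 → R} {m n g : ℕ}
    (hu : pairing M u u = 0) (hw : pairing M w w = 0) (hw' : pairing M w' w' = 0)
    (huv : pairing M u v ≠ 0) (huw : pairing M u w ≠ 0) (huw' : pairing M u w' ≠ 0)
    (hww' : pairing M w w' ≠ 0)
    (hg : 2 * eord p (pairing M u v) ≤ 2 * g + ord p (minors M))
    (hm : eord p (pairing M u w) = m) (hm' : eord p (pairing M u w') = m)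
    (h : pairing M u w * triple u v w' - pairing M u w' * triple u v w ∈ p ^ (m + g + n)) :
    eord p M.det + 2 * n ≤ eord p 2 + ord p (minors M) + eord p (pairing M w w') := by
  -- By `cramer_relation`, `h` bounds ord T(u,w,w') below by m + g + n - ord B(u,v). In the Gram
  -- identity the two pairings with u contribute 2m, which cancels and leaves the gain 2n.
  have hT := triple_ne_zero h2 hM hu hw hw' huw huw' hww'
  have h3 := two_mul_eord_triple (p := p) h2 hM hdet hu hw hw' huw huw' hww'
  rw [cramer_relation hu, mem_pow_iff hp (mul_ne_zero huv hT), eord_mul huv hT] at h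
  omega

end Local

/-- A family of isotropic vectors which are pairwise not orthogonal. -/
structure IsConicFamily {R ι : Type*} [CommRing R] (M : Matrix (Fin 3) (Fin 3) R)
    (Y : ι → Fin 3 → R) : Prop where
  isotropic : ∀ i, pairing M (Y i) (Y i) = 0
  pairing_ne_zero : ∀ i j, i ≠ j → pairing M (Y i) (Y j) ≠ 0

/-! ### Labels at one prime for a finite family -/

section Family

variable {R : Type*} [CommRing R] [IsDedekindDomain R] {p : Ideal R}
  {M : Matrix (Fin 3) (Fin 3) R} {ι : Type*} {Y : ι → Fin 3 → R} {S : Finset ι}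

/-- The pair `a`, `b` minimises the exponent of `p` in the pairings of members of the family. -/
structure IsExtremal (p : Ideal R) (M : Matrix (Fin 3) (Fin 3) R) (Y : ι → Fin 3 → R)
    (S : Finset ι) (a b : ι) : Prop where
  left_mem : a ∈ S
  right_mem : b ∈ S
  ne : a ≠ b
  le : ∀ i ∈ S, ∀ j ∈ S, i ≠ j →
    eord p (pairing M (Y a) (Y b)) ≤ eord p (pairing M (Y i) (Y j))

lemma exists_isExtremal (p : Ideal R) (M : Matrix (Fin 3) (Fin 3) R) (Y : ι → Fin 3 → R)
    {i j : ι} (hi : i ∈ S) (hj : j ∈ S) (hij : i ≠ j) : ∃ a b, IsExtremal p M Y S a b := by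
  classical
  obtain ⟨⟨a, b⟩, hab, hmin⟩ := S.offDiag.exists_min_image
    (fun q ↦ eord p (pairing M (Y q.1) (Y q.2))) ⟨(i, j), by simp [hi, hj, hij]⟩
  rw [Finset.mem_offDiag] at hab
  exact ⟨a, b, hab.1, hab.2.1, hab.2.2, fun x hx y hy hxy ↦ hmin (x, y) (by simp [hx, hy, hxy])⟩

lemma IsExtremal.symm (hM : M.IsSymm) {a b : ι} (h : IsExtremal p M Y S a b) :
    IsExtremal p M Y S b a :=
  ⟨h.right_mem, h.left_mem, h.ne.symm, by rw [pairing_comm hM]; exact h.le⟩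

lemma IsExtremal.mem (hp : Prime p) (hY : IsConicFamily M Y) {a b : ι}
    (h : IsExtremal p M Y S a b) {i j : ι} (hi : i ∈ S) (hj : j ∈ S) :
    pairing M (Y i) (Y j) ∈ p ^ eord p (pairing M (Y a) (Y b)) := by
  by_cases hij : i = j
  · rw [hij, hY.isotropic]; exact zero_mem _
  · exact (mem_pow_iff hp (hY.pairing_ne_zero i j hij)).2 (h.le i hi j hj hij)

/-- The exponent of `p` in the pairing with the vector `u`, truncated at `f`. -/
noncomputable def truncatedOrd (p : Ideal R) (M : Matrix (Fin 3) (Fin 3) R) (f : ℕ)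
    (u w : Fin 3 → R) : ℕ := by
  -- Zero counts as infinitely divisible here, whereas `eord p 0` is 0.
  classical exact if pairing M u w = 0 then f else min (eord p (pairing M u w)) f

lemma truncatedOrd_le (f : ℕ) (u w : Fin 3 → R) : truncatedOrd p M f u w ≤ f := by
  unfold truncatedOrd; split_ifs <;> simp

lemma truncatedOrd_of_ne_zero {f : ℕ} {u w : Fin 3 → R} (h : pairing M u w ≠ 0) :
    truncatedOrd p M f u w = min (eord p (pairing M u w)) f := by
  simp [truncatedOrd, h]

lemma mem_of_truncatedOrd_eq (hp : Prime p) {f : ℕ} {u w : Fin 3 → R}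
    (h : truncatedOrd p M f u w = f) : pairing M u w ∈ p ^ f := by
  by_cases h0 : pairing M u w = 0
  · simp [h0]
  · rw [truncatedOrd_of_ne_zero h0] at h
    rw [mem_pow_iff hp h0]
    omega

lemma ne_zero_of_eord_eq_one {x : R} (hx : eord p x = 1) : x ≠ 0 := by
  rintro rfl
  have h0 : Ideal.span {(0 : R)} = 0 := by simp
  rw [eord, ord, h0, UniqueFactorizationMonoid.normalizedFactors_zero] at hx
  simp at hx

lemma exists_eord_eq_one (hp : Prime p) : ∃ x : R, eord p x = 1 := by
  have : p.IsPrime := Ideal.isPrime_of_prime hp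
  obtain ⟨x, hx, hx'⟩ := Ideal.exists_mem_pow_notMem_pow_succ p hp.ne_zero
    this.ne_top 1
  exact ⟨x, eord_eq hp hx hx'⟩

/-- Two vectors with the same residue relative to the reference pair are close. -/
lemma cross_mem_of_residue_eq (hp : Prime p) {π : R} (hπ : eord p π = 1) {m g n : ℕ}
    {α α' D D' s s' : R} (hα : α ∈ p ^ m) (hα' : α' ∈ p ^ m)
    (h : π ^ m * D - α * π ^ g * s ∈ p ^ (m + g + n))
    (h' : π ^ m * D' - α' * π ^ g * s' ∈ p ^ (m + g + n)) (hs : s - s' ∈ p ^ n) :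
    α * D' - α' * D ∈ p ^ (m + g + n) := by
  have hπ0 : π ≠ 0 := ne_zero_of_eord_eq_one hπ
  have hπg : π ^ g ∈ p ^ g := by rw [mem_pow_iff hp (pow_ne_zero _ hπ0), eord_pow, hπ, mul_one]
  refine mem_pow_of_mul_mem hp (pow_ne_zero m hπ0) (m := m + (m + g + n)) ?_
    (by rw [eord_pow, hπ]; omega)
  have e : π ^ m * (α * D' - α' * D) = α * (π ^ m * D' - α' * π ^ g * s')
      - α' * (π ^ m * D - α * π ^ g * s) - α * (α' * π ^ g * (s - s')) := by ring
  rw [e]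
  exact sub_mem (sub_mem (mul_mem_pow_add hα h') (mul_mem_pow_add hα' h))
    (mul_mem_pow_add hα (mul_mem_pow_add (mul_mem_pow_add hα' hπg) hs))

/-- The element s stands for (D/π^g)/(α/π^m) with m = ord α, the ratio D/α scaled to be integral at
p. -/
lemma exists_residue (hp : Prime p) {π : R} (hπ : eord p π = 1) {g : ℕ} (n : ℕ)
    {α D : R} (hα : α ≠ 0) (hD : D ∈ p ^ g) :
    ∃ s, π ^ eord p α * D - α * π ^ g * s ∈ p ^ (eord p α + g + n) := by
  have hπ0 : π ≠ 0 := ne_zero_of_eord_eq_one hπ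
  refine exists_sub_mul_mem hp n (mul_ne_zero hα (pow_ne_zero _ hπ0)) ?_ (mul_mem_pow_add ?_ hD)
  · rw [eord_mul hα (pow_ne_zero _ hπ0), eord_pow, hπ, mul_one]
  · rw [mem_pow_iff hp (pow_ne_zero _ hπ0), eord_pow, hπ, mul_one]

variable (h2 : (2 : R) ≠ 0) (hM : M.IsSymm) (hdet : M.det ≠ 0) (hp : Prime p)
  (hY : IsConicFamily M Y)

include h2 hM hdet hp hY

lemma IsExtremal.triple_mem {a b : ι} (h : IsExtremal p M Y S a b) {i : ι} (hi : i ∈ S) :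
    triple (Y a) (Y b) (Y i) ∈
      p ^ (eord p (pairing M (Y a) (Y b)) - ord p (minors M) / 2) := by
  by_cases hia : i = a
  · simp [hia]
  by_cases hib : i = b
  · simp [hib]
  have huv := hY.pairing_ne_zero a b h.ne
  have huw := hY.pairing_ne_zero a i (Ne.symm hia)
  have hvw := hY.pairing_ne_zero b i (Ne.symm hib)
  have hT := triple_ne_zero h2 hM (hY.isotropic a) (hY.isotropic b) (hY.isotropic i) huv huw hvw
  have := two_mul_le_of_pairing_mem h2 hM hdet hp (hY.isotropic a) (hY.isotropic b)
    (hY.isotropic i) huv huw hvw (h.mem hp hY h.left_mem h.right_mem)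
    (h.mem hp hY h.left_mem hi) (h.mem hp hY h.right_mem hi)
  rw [mem_pow_iff hp hT]
  omega

/-- At every prime, the isotropic vectors fall into few classes of mutually close ones. -/
theorem exists_local_classes (S : Finset ι) :
    ∃ c : ι → ℕ, (∀ i, c i ≤ eord p M.det - ord p (minors M)) ∧
      ∀ i ∈ S, ∀ j ∈ S, i ≠ j → c i = c j →
        eord p M.det ≤ eord p 2 + ord p (minors M) + eord p (pairing M (Y i) (Y j)) := by
  by_cases hS : ∃ i ∈ S, ∃ j ∈ S, i ≠ j
  swap
  · push Not at hS
    exact ⟨0, fun _ ↦ Nat.zero_le _, fun i hi j hj hij ↦ absurd (hS i hi j hj) hij⟩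
  obtain ⟨i, hi, j, hj, hij⟩ := hS
  obtain ⟨a, b, hab⟩ := exists_isExtremal p M Y hi hj hij
  have hle := ord_minors_le hp hdet
  set f := eord p M.det - ord p (minors M) with hf
  refine ⟨fun i ↦ truncatedOrd p M f (Y a) (Y i), fun i ↦ truncatedOrd_le _ _ _, ?_⟩
  intro i hi j hj hij hc
  have hne := hY.pairing_ne_zero i j hij
  -- At the truncation level the exponents of B(a,i) and B(a,j) may differ and i or j may be a
  -- itself, so the argument uses the product of two triples. Below it they agree and
  -- `cramer_relation` applies.
  by_cases hfull : truncatedOrd p M f (Y a) (Y i) = f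
  · have hmem := pairing_mem_of_both_mem hM hp (hY.isotropic a) (hY.isotropic b) (hY.isotropic i)
      (hY.isotropic j) (hY.pairing_ne_zero a b hab.ne) (mem_of_truncatedOrd_eq hp hfull)
      (mem_of_truncatedOrd_eq hp (hc.symm.trans hfull)) (hab.mem hp hY hab.right_mem hi)
      (hab.mem hp hY hab.right_mem hj)
    rw [mem_pow_iff hp hne] at hmem
    omega
  · have hai : pairing M (Y a) (Y i) ≠ 0 := fun h ↦ hfull (by simp [truncatedOrd, h])
    have haj : pairing M (Y a) (Y j) ≠ 0 := fun h ↦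
      hfull (hc.trans (by simp [truncatedOrd, h]))
    simp only [truncatedOrd_of_ne_zero hai, truncatedOrd_of_ne_zero haj] at hc hfull
    have heq : eord p (pairing M (Y a) (Y j)) = eord p (pairing M (Y a) (Y i)) := by omega
    have h := le_eord_pairing (n := 0)
      (g := eord p (pairing M (Y a) (Y b)) - ord p (minors M) / 2) h2 hM hdet hp
      (hY.isotropic a) (hY.isotropic i) (hY.isotropic j)
      (hY.pairing_ne_zero a b hab.ne) hai haj hne (by omega) rfl heq
      (by
        rw [add_zero]
        exact sub_mem (mul_mem_pow_add (eord_mem hp _) (hab.triple_mem h2 hM hdet hp hY hj))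
          (mul_mem_pow_add (heq ▸ eord_mem hp _) (hab.triple_mem h2 hM hdet hp hY hi)))
    omega

lemma le_eord_pairing_of_residue_eq {a b : ι} (h : IsExtremal p M Y S a b) {π : R}
    (hπ : eord p π = 1) {n : ℕ} {i j : ι} (hi : i ∈ S) (hj : j ∈ S) (hij : i ≠ j)
    (hai : pairing M (Y a) (Y i) ≠ 0) (haj : pairing M (Y a) (Y j) ≠ 0)
    (heq : eord p (pairing M (Y a) (Y j)) = eord p (pairing M (Y a) (Y i)))
    {s : ι → R} (hs : ∀ k ∈ S, pairing M (Y a) (Y k) ≠ 0 →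
      π ^ eord p (pairing M (Y a) (Y k)) * triple (Y a) (Y b) (Y k) -
        pairing M (Y a) (Y k) *
          π ^ (eord p (pairing M (Y a) (Y b)) - ord p (minors M) / 2) * s k ∈
      p ^ (eord p (pairing M (Y a) (Y k)) +
        (eord p (pairing M (Y a) (Y b)) - ord p (minors M) / 2) + n))
    (hsij : s i - s j ∈ p ^ n) :
    eord p M.det + 2 * n ≤
      eord p 2 + ord p (minors M) + eord p (pairing M (Y i) (Y j)) := by
  have hsj := hs j hj haj
  rw [heq] at hsj
  refine le_eord_pairing h2 hM hdet hp
    (g := eord p (pairing M (Y a) (Y b)) - ord p (minors M) / 2)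
    (hY.isotropic a) (hY.isotropic i) (hY.isotropic j)
    (hY.pairing_ne_zero a b h.ne) hai haj (hY.pairing_ne_zero i j hij) (by omega) rfl heq
    (cross_mem_of_residue_eq hp hπ (eord_mem hp _) (heq ▸ eord_mem hp _) (hs i hi hai) hsj hsij)

/-- At a prime where all vectors are primitive, the classes can be refined. -/
theorem exists_refined_classes (S : Finset ι) (hprim : ∀ i, ∃ k, Y i k ∉ p) (n : ℕ) :
    ∃ c : ι → ℕ, (∀ i, c i ≤ eord p M.det - ord p (minors M)) ∧
      ∃ t : ι → Bool × (R ⧸ p ^ n),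
      ∀ i ∈ S, ∀ j ∈ S, i ≠ j → c i = c j → t i = t j →
        eord p M.det + 2 * n ≤
          eord p 2 + ord p (minors M) + eord p (pairing M (Y i) (Y j)) := by
  classical
  by_cases hS : ∃ i ∈ S, ∃ j ∈ S, i ≠ j
  swap
  · push Not at hS
    exact ⟨0, fun _ ↦ Nat.zero_le _, fun _ ↦ (true, 0),
      fun i hi j hj hij ↦ absurd (hS i hi j hj) hij⟩
  obtain ⟨i, hi, j, hj, hij⟩ := hS
  obtain ⟨a, b, hab⟩ := exists_isExtremal p M Y hi hj hij
  have hba := hab.symm hM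
  have hle := ord_minors_le hp hdet
  obtain ⟨π, hπ⟩ := exists_eord_eq_one hp
  have hres : ∀ a b, IsExtremal p M Y S a b → ∃ s : ι → R,
      ∀ k ∈ S, pairing M (Y a) (Y k) ≠ 0 →
      π ^ eord p (pairing M (Y a) (Y k)) * triple (Y a) (Y b) (Y k) -
        pairing M (Y a) (Y k) *
          π ^ (eord p (pairing M (Y a) (Y b)) - ord p (minors M) / 2) * s k ∈
      p ^ (eord p (pairing M (Y a) (Y k)) +
        (eord p (pairing M (Y a) (Y b)) - ord p (minors M) / 2) + n) := by
    intro a b hab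
    have : ∀ k, ∃ s, k ∈ S → pairing M (Y a) (Y k) ≠ 0 →
      π ^ eord p (pairing M (Y a) (Y k)) * triple (Y a) (Y b) (Y k) -
        pairing M (Y a) (Y k) *
          π ^ (eord p (pairing M (Y a) (Y b)) - ord p (minors M) / 2) * s ∈
      p ^ (eord p (pairing M (Y a) (Y k)) +
        (eord p (pairing M (Y a) (Y b)) - ord p (minors M) / 2) + n) := by
      intro k
      by_cases hk : k ∈ S ∧ pairing M (Y a) (Y k) ≠ 0
      · obtain ⟨s, hs⟩ := exists_residue hp hπ n hk.2 (hab.triple_mem h2 hM hdet hp hY hk.1)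
        exact ⟨s, fun _ _ ↦ hs⟩
      · exact ⟨0, fun h h' ↦ absurd ⟨h, h'⟩ hk⟩
    choose s hs using this
    exact ⟨s, hs⟩
  obtain ⟨s, hs⟩ := hres a b hab
  obtain ⟨s', hs'⟩ := hres b a hba
  set f := eord p M.det - ord p (minors M) with hf
  set β := eord p (pairing M (Y a) (Y b)) with hβ
  have hβ' : eord p (pairing M (Y b) (Y a)) = β := by rw [pairing_comm hM]
  -- Flagged points are projected from b, where they all have exponent β; the others are projected
  -- from a.
  let flag : ι → Prop := fun i ↦ pairing M (Y b) (Y i) ≠ 0 ∧ eord p (pairing M (Y b) (Y i)) = β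
  refine ⟨fun i ↦ truncatedOrd p M f (Y a) (Y i), fun i ↦ truncatedOrd_le _ _ _,
    fun i ↦ (decide (flag i), if flag i then Ideal.Quotient.mk _ (s' i)
      else Ideal.Quotient.mk _ (s i)), ?_⟩
  intro i hi j hj hij hc ht
  obtain ⟨hflag, hst⟩ := Prod.mk.inj ht
  have hiff : flag i ↔ flag j := by simpa using hflag
  by_cases hfi : flag i
  · have hfj := hiff.1 hfi
    rw [if_pos hfi, if_pos hfj, Ideal.Quotient.eq] at hst
    exact le_eord_pairing_of_residue_eq h2 hM hdet hp hY hba hπ hi hj hij hfi.1 hfj.1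
      (hfj.2.trans hfi.2.symm) hs' hst
  · have hfj : ¬ flag j := fun h ↦ hfi (hiff.2 h)
    rw [if_neg hfi, if_neg hfj, Ideal.Quotient.eq] at hst
    -- For unflagged points truncation loses nothing: if both pairings with a and b exceed β,
    -- primitivity and `three_point_reverse` force ord B(a,k) < f.
    have hsmall : ∀ k ∈ S, ¬ flag k → pairing M (Y a) (Y k) ≠ 0 ∧
        (eord p (pairing M (Y a) (Y k)) < f ∨ eord p (pairing M (Y a) (Y k)) = β) := by
      intro k hk hfk
      have hka : a ≠ k := by
        rintro rfl
        exact hfk ⟨hY.pairing_ne_zero _ _ hab.ne.symm, hβ'⟩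
      have hak := hY.pairing_ne_zero a k hka
      refine ⟨hak, ?_⟩
      by_cases hkb : b = k
      · right; rw [← hkb]
      have hbk := hY.pairing_ne_zero b k hkb
      have h1 := hab.le b hab.right_mem k hk hkb
      have h3 := hab.le a hab.left_mem k hk hka
      have h4 : eord p (pairing M (Y b) (Y k)) ≠ β := fun h ↦ hfk ⟨hbk, h⟩
      by_contra! hcon
      have := three_point_reverse h2 hM hdet hp (hY.isotropic a) (hY.isotropic b)
        (hY.isotropic k) (hY.pairing_ne_zero a b hab.ne) hak hbk
        ((mem_pow_iff hp hak).2 (by omega)) ((mem_pow_iff hp hbk).2 (by omega)) (hprim k)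
      omega
    obtain ⟨hai, hi'⟩ := hsmall i hi hfi
    obtain ⟨haj, hj'⟩ := hsmall j hj hfj
    simp only [truncatedOrd_of_ne_zero hai, truncatedOrd_of_ne_zero haj] at hc
    exact le_eord_pairing_of_residue_eq h2 hM hdet hp hY hab hπ hi hj hij hai haj (by omega)
      hs hst

end Family

open UniqueFactorizationMonoid

/-! ### Assembling the labels at all primes -/

section Count

variable {R : Type*} [CommRing R] [IsDedekindDomain R]

lemma finite_setOf_dvd {I : Ideal R} (hI : I ≠ 0) : {J : Ideal R | J ∣ I}.Finite := by
  classical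
  refine Set.Finite.of_finite_image (f := normalizedFactors)
    ((Set.finite_Iic (normalizedFactors I)).subset ?_) ?_
  · rintro _ ⟨J, hJ, rfl⟩
    exact (dvd_iff_normalizedFactors_le_normalizedFactors (ne_zero_of_dvd_ne_zero hI hJ) hI).1 hJ
  · intro J hJ K hK h
    rw [← Ideal.prod_normalizedFactors_eq_self (ne_zero_of_dvd_ne_zero hI hJ), h,
      Ideal.prod_normalizedFactors_eq_self (ne_zero_of_dvd_ne_zero hI hK)]

/-- Ideals with prescribed exponents. -/
lemma exists_dvd_with_ord {I : Ideal R} (hI : I ≠ 0) (c : Ideal R → ℕ)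
    (hc : ∀ q, Prime q → c q ≤ ord q I) : ∃ J, J ∣ I ∧ ∀ q, Prime q → ord q J = c q := by
  classical
  set m : Multiset (Ideal R) := ∑ q ∈ (normalizedFactors I).toFinset, Multiset.replicate (c q) q
    with hm
  have hcount : ∀ q, m.count q = if q ∈ normalizedFactors I then c q else 0 := by
    intro q
    rw [hm, Multiset.count_sum']
    simp only [Multiset.count_replicate, Finset.sum_ite_eq', Multiset.mem_toFinset]
  have hle : m ≤ normalizedFactors I := by
    rw [Multiset.le_iff_count]
    intro q
    rw [hcount]
    split_ifs with h
    · simpa only [ord] using hc q (prime_of_normalized_factor q h)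
    · exact Nat.zero_le _
  have hnf : normalizedFactors m.prod = m :=
    normalizedFactors_prod_of_prime fun q hq ↦
      prime_of_normalized_factor q (Multiset.mem_of_le hle hq)
  refine ⟨m.prod, ?_, fun q hq ↦ ?_⟩
  · conv_rhs => rw [← Ideal.prod_normalizedFactors_eq_self hI]
    exact Multiset.prod_dvd_prod_of_le hle
  · have h := hcount q
    have hcq := hc q hq
    simp only [ord, hnf] at hcq ⊢
    rw [h]
    split_ifs with hmem
    · rfl
    · rw [Multiset.count_eq_zero_of_notMem hmem] at hcq
      omega

variable [Module.Free ℤ R] [Module.Finite ℤ R]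

/-- Isotropic vectors are bounded in number by classes, if no three of them are mutually close. -/
theorem card_le_of_not_dvd (h2 : (2 : R) ≠ 0) {M : Matrix (Fin 3) (Fin 3) R} (hM : M.IsSymm)
    (hdet : M.det ≠ 0) {ι : Type*} {Y : ι → Fin 3 → R} (hY : IsConicFamily M Y) (S : Finset ι)
    {P : Ideal R} (hP : Prime P) (hprim : ∀ i, ∃ k, Y i k ∉ P) (n : ℕ)
    (hno : ∀ i ∈ S, ∀ j ∈ S, ∀ l ∈ S, triple (Y i) (Y j) (Y l) ≠ 0 →
      ¬ Ideal.span {M.det} ^ 2 * P ^ (6 * n) ∣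
        Ideal.span {triple (Y i) (Y j) (Y l)} ^ 2 * minors M ^ 3 * Ideal.span {2} ^ 2) :
    S.card ≤ 2 * (Set.ncard {J : Ideal R | J ∣ Ideal.span {M.det}} *
      (2 * Ideal.absNorm P ^ n)) := by
  classical
  obtain ⟨cP, hcP, t, ht⟩ := exists_refined_classes h2 hM hdet hP hY S hprim n
  have hclass : ∀ q, ∃ c : ι → ℕ, Prime q → (∀ i, c i ≤ eord q M.det - ord q (minors M)) ∧
      ∀ i ∈ S, ∀ j ∈ S, i ≠ j → c i = c j → t i = t j →
        eord q M.det + 2 * (if q = P then n else 0) ≤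
          eord q 2 + ord q (minors M) + eord q (pairing M (Y i) (Y j)) := by
    intro q
    by_cases hq : Prime q
    swap
    · exact ⟨0, fun h ↦ absurd h hq⟩
    by_cases hqP : q = P
    · subst hqP
      exact ⟨cP, fun _ ↦ ⟨hcP, by simpa using ht⟩⟩
    · obtain ⟨c, hc, h⟩ := exists_local_classes h2 hM hdet hq hY S
      exact ⟨c, fun _ ↦ ⟨hc, fun i hi j hj hij hcij _ ↦ by
        simpa [hqP] using h i hi j hj hij hcij⟩⟩
  choose c hc using hclass
  have hdet' := span_ne_zero hdet
  have hJ : ∀ i, ∃ J, J ∣ Ideal.span {M.det} ∧ ∀ q, Prime q → ord q J = c q i := fun i ↦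
    exists_dvd_with_ord hdet' (fun q ↦ c q i) fun q hq ↦
      ((hc q hq).1 i).trans (Nat.sub_le _ _)
  choose J hJdvd hJord using hJ
  have hPn : P ^ n ≠ ⊥ := pow_ne_zero n hP.ne_zero
  have : Finite (R ⧸ P ^ n) := Ideal.finiteQuotientOfFreeOfNeBot _ hPn
  have : Fintype (R ⧸ P ^ n) := Fintype.ofFinite _
  have hfin := finite_setOf_dvd hdet'
  have himage : (S.image fun i ↦ (J i, t i)) ⊆ hfin.toFinset ×ˢ Finset.univ := by
    intro x hx
    obtain ⟨i, -, rfl⟩ := Finset.mem_image.1 hx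
    exact Finset.mem_product.2 ⟨hfin.mem_toFinset.2 (hJdvd i), Finset.mem_univ _⟩
  have hcard := Finset.card_le_card himage
  rw [Finset.card_product, ← Set.ncard_eq_toFinset_card _ hfin, Finset.card_univ,
    Fintype.card_prod, Fintype.card_bool, ← Nat.card_eq_fintype_card,
    ← Submodule.cardQuot_apply, ← Ideal.absNorm_apply, map_pow] at hcard
  -- A fibre with three points would contradict `hno`.
  refine (Finset.card_le_mul_card_image S 2 ?_).trans (Nat.mul_le_mul_left 2 hcard)
  intro x _
  by_contra! hx
  obtain ⟨i, j, l, hi, hj, hl, hij, hil, hjl⟩ := Finset.two_lt_card_iff.1 hx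
  simp only [Finset.mem_filter] at hi hj hl
  have hne := triple_ne_zero h2 hM (hY.isotropic i) (hY.isotropic j) (hY.isotropic l)
    (hY.pairing_ne_zero i j hij) (hY.pairing_ne_zero i l hil) (hY.pairing_ne_zero j l hjl)
  refine hno i hi.1 j hj.1 l hl.1 hne ?_
  have hmin := minors_ne_zero hdet
  have ht0 := span_ne_zero hne
  have h20 := span_ne_zero h2
  have hP0 := hP.ne_zero
  refine dvd_of_forall_ord_le (mul_ne_zero (pow_ne_zero _ hdet') (pow_ne_zero _ hP0))
    (mul_ne_zero (mul_ne_zero (pow_ne_zero _ ht0) (pow_ne_zero _ hmin)) (pow_ne_zero _ h20)) ?_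
  intro q hq
  rw [ord_mul (pow_ne_zero _ hdet') (pow_ne_zero _ hP0),
    ord_mul (mul_ne_zero (pow_ne_zero _ ht0) (pow_ne_zero _ hmin)) (pow_ne_zero _ h20),
    ord_mul (pow_ne_zero _ ht0) (pow_ne_zero _ hmin)]
  simp only [ord_pow, ord_prime hP]
  have hclose : ∀ {i j}, i ∈ S ∧ (J i, t i) = x → j ∈ S ∧ (J j, t j) = x → i ≠ j →
      eord q M.det + 2 * (if q = P then n else 0) ≤
        eord q 2 + ord q (minors M) + eord q (pairing M (Y i) (Y j)) := by
    intro i j hi hj hij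
    have h := hi.2.trans hj.2.symm
    obtain ⟨hJij, htij⟩ := Prod.mk.inj h
    exact (hc q hq).2 i hi.1 j hj.1 hij (by rw [← hJord i q hq, ← hJord j q hq, hJij]) htij
  -- Adding the three lower bounds for the pairings to the Gram identity gives 2 ord det M + 6n ≤ 2
  -- ord T + 3 ord Δ₀ + 2 ord 2, with n present only at P.
  have e1 := hclose hi hj hij
  have e2 := hclose hi hl hil
  have e3 := hclose hj hl hjl
  have e4 := two_mul_eord_triple (p := q) h2 hM hdet (hY.isotropic i) (hY.isotropic j)
    (hY.isotropic l) (hY.pairing_ne_zero i j hij) (hY.pairing_ne_zero i l hil)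
    (hY.pairing_ne_zero j l hjl)
  simp only [eord] at e1 e2 e3 e4
  simp only [eq_comm (a := q)] at e1 e2 e3 ⊢
  split_ifs at * <;> omega

end Count

/-! ### Norms, boxes and the choice of n -/

section NumberField

variable {k : Type*} [Field k] [NumberField k]

lemma form_coe {k : Type*} [Field k] (M : Matrix (Fin 3) (Fin 3) (𝓞 k)) (y : Fin 3 → 𝓞 k) :
    form M (fun i ↦ (y i : k)) = algebraMap (𝓞 k) k (pairing M y y) := by
  simp only [form, Matrix.toQuadraticForm', LinearMap.BilinMap.toQuadraticMap_apply,
    Matrix.toLinearMap₂'_apply', pairing, dotProduct, mulVec, map_sum, map_mul, Matrix.map_apply]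

lemma finite_box {r : InfinitePlace k → ℝ} (hr : ∀ v, 1 ≤ r v) : (box r).Finite := by
  have hfin := Embeddings.finite_of_norm_le k ℂ (∑ v : InfinitePlace k, r v)
  refine Set.Finite.of_finite_image (f := fun x : 𝓞 k ↦ (x : k)) (hfin.subset ?_)
    (RingOfIntegers.coe_injective.injOn)
  rintro _ ⟨x, hx, rfl⟩
  refine ⟨x.isIntegral_coe, fun φ ↦ ?_⟩
  have h := hx (InfinitePlace.mk φ)
  rw [InfinitePlace.apply] at h
  have hle : ‖φ x‖ ≤ r (InfinitePlace.mk φ) := by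
    rcases le_total ‖φ x‖ 1 with h1 | h1
    · exact h1.trans (hr _)
    · exact (le_self_pow₀ h1 InfinitePlace.mult_ne_zero).trans h
  exact hle.trans (Finset.single_le_sum (f := r) (fun v _ ↦ zero_le_one.trans (hr v))
    (Finset.mem_univ _))

lemma absNorm_span_eq_prod (x : 𝓞 k) :
    (Ideal.absNorm (Ideal.span {x}) : ℝ) = ∏ v : InfinitePlace k, v (x : k) ^ v.mult := by
  rw [InfinitePlace.prod_eq_abs_norm, Ideal.absNorm_span_singleton, ← Algebra.coe_norm_int,
    Nat.cast_natAbs]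
  simp

lemma place_triple_le {k : Type*} [Field k] (v : InfinitePlace k) {R₀ R₁ R₂ : ℝ} {y : Fin 3 → Fin 3 → 𝓞 k}
    (h₀ : ∀ j, v (y j 0 : k) ^ v.mult ≤ R₀) (h₁ : ∀ j, v (y j 1 : k) ^ v.mult ≤ R₁)
    (h₂ : ∀ j, v (y j 2 : k) ^ v.mult ≤ R₂) :
    v ((triple (y 0) (y 1) (y 2) : 𝓞 k) : k) ^ v.mult ≤ 36 * (R₀ * R₁ * R₂) := by
  -- The largest absolute value in each coordinate replaces a root of the bound; the determinant has
  -- six monomials, and 36 = 6² covers complex places.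
  have hmax : ∀ i, ∃ A, 0 ≤ A ∧ (∃ j, A = v (y j i : k)) ∧ ∀ j, v (y j i : k) ≤ A := by
    intro i
    obtain ⟨j, hj⟩ := Finite.exists_max fun j ↦ v (y j i : k)
    exact ⟨v (y j i), apply_nonneg _ _, ⟨j, rfl⟩, hj⟩
  obtain ⟨A₀, p₀, ⟨j₀, e₀⟩, m₀⟩ := hmax 0
  obtain ⟨A₁, p₁, ⟨j₁, e₁⟩, m₁⟩ := hmax 1
  obtain ⟨A₂, p₂, ⟨j₂, e₂⟩, m₂⟩ := hmax 2
  have hterm : ∀ a b c, v ((y a 0 : k) * (y b 1 : k) * (y c 2 : k)) ≤ A₀ * A₁ * A₂ := by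
    intro a b c
    rw [map_mul, map_mul]
    have := m₀ a; have := m₁ b; have := m₂ c
    gcongr
  have hdet : v ((triple (y 0) (y 1) (y 2) : 𝓞 k) : k) ≤ 6 * (A₀ * A₁ * A₂) := by
    have e : ((triple (y 0) (y 1) (y 2) : 𝓞 k) : k) =
        (y 0 0 : k) * (y 1 1 : k) * (y 2 2 : k) - (y 0 0 : k) * (y 2 1 : k) * (y 1 2 : k)
        - (y 1 0 : k) * (y 0 1 : k) * (y 2 2 : k) + (y 2 0 : k) * (y 0 1 : k) * (y 1 2 : k)
        + (y 1 0 : k) * (y 2 1 : k) * (y 0 2 : k) - (y 2 0 : k) * (y 1 1 : k) * (y 0 2 : k) := by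
      simp only [triple, det_fin_three, of_apply, cons_val', cons_val_zero, cons_val_one, cons_val,
        map_add, map_sub, map_mul]
      ring
    have hsub : ∀ a b : k, v (a - b) ≤ v a + v b := fun a b ↦ by
      have := v.1.sub_le_add a b
      exact this
    rw [e]
    refine (hsub _ _).trans ?_
    refine (add_le_add_left (v.1.add_le _ _) _).trans ?_
    refine (add_le_add_left (add_le_add_left (v.1.add_le _ _) _) _).trans ?_
    refine (add_le_add_left (add_le_add_left (add_le_add_left (hsub _ _) _) _) _).trans ?_
    refine (add_le_add_left (add_le_add_left (add_le_add_left (add_le_add_left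
      (hsub _ _) _) _) _) _).trans ?_
    have := hterm 0 1 2
    have := hterm 0 2 1
    have := hterm 1 0 2
    have := hterm 2 0 1
    have := hterm 1 2 0
    have := hterm 2 1 0
    have hv : ∀ x : k, v.1 x = v x := fun _ ↦ rfl
    simp only [hv]
    linarith
  have hmult : (6 : ℝ) ^ v.mult ≤ 36 := by
    rcases v.isReal_or_isComplex with h | h
    · rw [InfinitePlace.mult, if_pos h]; norm_num
    · rw [InfinitePlace.mult, if_neg (InfinitePlace.not_isReal_iff_isComplex.2 h)]; norm_num
  have q₀ : 0 ≤ A₀ ^ v.mult := pow_nonneg p₀ _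
  have q₁ : 0 ≤ A₁ ^ v.mult := pow_nonneg p₁ _
  have q₂ : 0 ≤ A₂ ^ v.mult := pow_nonneg p₂ _
  have s₀ : A₀ ^ v.mult ≤ R₀ := e₀ ▸ h₀ j₀
  have s₁ : A₁ ^ v.mult ≤ R₁ := e₁ ▸ h₁ j₁
  have s₂ : A₂ ^ v.mult ≤ R₂ := e₂ ▸ h₂ j₂
  calc _ ≤ (6 * (A₀ * A₁ * A₂)) ^ v.mult := pow_le_pow_left₀ (apply_nonneg _ _) hdet _
    _ = 6 ^ v.mult * (A₀ ^ v.mult * A₁ ^ v.mult * A₂ ^ v.mult) := by rw [mul_pow, mul_pow, mul_pow]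
    _ ≤ 36 * (R₀ * R₁ * R₂) := by
      have := q₀.trans s₀
      have := q₁.trans s₁
      gcongr

lemma absNorm_triple_le {r : Fin 3 → InfinitePlace k → ℝ} {u v w : Fin 3 → 𝓞 k}
    (hu : ∀ i, u i ∈ box (r i)) (hv : ∀ i, v i ∈ box (r i)) (hw : ∀ i, w i ∈ box (r i)) :
    (Ideal.absNorm (Ideal.span {triple u v w}) : ℝ) ≤
      36 ^ Fintype.card (InfinitePlace k) * (boxNorm (r 0) * boxNorm (r 1) * boxNorm (r 2)) := by
  rw [absNorm_span_eq_prod, boxNorm, boxNorm, boxNorm, ← Finset.prod_mul_distrib,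
    ← Finset.prod_mul_distrib, ← Finset.card_univ, ← Finset.prod_const, ← Finset.prod_mul_distrib]
  refine Finset.prod_le_prod (fun ν _ ↦ pow_nonneg (apply_nonneg _ _) _) fun ν _ ↦ ?_
  have h : ∀ i j, ν ((![u, v, w] j i : 𝓞 k) : k) ^ ν.mult ≤ r i ν := by
    intro i j
    fin_cases j
    · exact hu i ν
    · exact hv i ν
    · exact hw i ν
  exact place_triple_le ν (y := ![u, v, w]) (h 0) (h 1) (h 2)

/-- A prime ideal which divides none of the chosen ideals. -/
lemma exists_prime_not_le (a : ClassGroup (𝓞 k) → (Ideal (𝓞 k))⁰) :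
    ∃ P : Ideal (𝓞 k), Prime P ∧ ∀ c, ¬ (a c : Ideal (𝓞 k)) ≤ P := by
  set I : Ideal (𝓞 k) := ∏ c, (a c : Ideal (𝓞 k)) with hI
  have hI0 : I ≠ ⊥ := Finset.prod_ne_zero_iff.2 fun c _ ↦ nonZeroDivisors.coe_ne_zero (a c)
  -- The norm of I lies in every chosen ideal, so a prime containing both m and one of these ideals
  -- would contain 1.
  set m : ℕ := Ideal.absNorm I + 1 with hm
  have hm2 : 2 ≤ m := by
    have : Ideal.absNorm I ≠ 0 := by rwa [Ne, Ideal.absNorm_eq_zero_iff]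
    omega
  have hunit : ¬ IsUnit (algebraMap ℤ (𝓞 k) m) := by
    intro h
    have h1 := h.map (Algebra.norm ℤ)
    rw [Algebra.norm_algebraMap_of_basis (Module.Free.chooseBasis ℤ (𝓞 k)),
      isUnit_pow_iff Fintype.card_ne_zero, Int.isUnit_iff] at h1
    omega
  obtain ⟨P, hP, hle⟩ := Ideal.exists_le_maximal (Ideal.span {algebraMap ℤ (𝓞 k) m})
    (by rwa [Ne, Ideal.span_singleton_eq_top])
  have hmP : algebraMap ℤ (𝓞 k) m ∈ P := hle (Ideal.mem_span_singleton_self _)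
  have hP0 : P ≠ ⊥ := by
    rintro rfl
    rw [Ideal.mem_bot, map_eq_zero_iff _ (FaithfulSMul.algebraMap_injective ℤ (𝓞 k))] at hmP
    omega
  refine ⟨P, Ideal.prime_of_isPrime hP0 hP.isPrime, fun c hc ↦ hP.ne_top ?_⟩
  have h1 : (Ideal.absNorm I : 𝓞 k) ∈ P :=
    hc (Ideal.le_of_dvd (Finset.dvd_prod_of_mem _ (Finset.mem_univ c)) (Ideal.absNorm_mem I))
  rw [Ideal.eq_top_iff_one]
  have := sub_mem hmP h1
  simpa [hm] using this

lemma pow_le_of_sq_le {N N₀ K T V D q : ℝ} {m : ℕ} (hN : 0 < N) (hN₀ : 0 < N₀) (hK : 0 ≤ K)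
    (hT : 0 ≤ T) (hV : 0 ≤ V) (hD : 0 ≤ D) (hDV : D ≤ K * V)
    (h : N ^ 2 * q ^ (6 * m) ≤ D ^ 2 * N₀ ^ 3 * T ^ 2) :
    q ^ (3 * m) ≤ K * T * (V * N₀ ^ (3 / 2 : ℝ) / N) := by
  have hsq : (N₀ ^ (3 / 2 : ℝ)) ^ 2 = N₀ ^ 3 := by
    rw [← Real.rpow_natCast, ← Real.rpow_mul hN₀.le, ← Real.rpow_natCast]
    norm_num
  rw [← mul_div_assoc, le_div_iff₀ hN]
  refine le_of_sq_le_sq ?_ (by positivity)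
  calc (q ^ (3 * m) * N) ^ 2 = N ^ 2 * q ^ (6 * m) := by ring
    _ ≤ D ^ 2 * N₀ ^ 3 * T ^ 2 := h
    _ ≤ (K * V) ^ 2 * N₀ ^ 3 * T ^ 2 := by gcongr
    _ = (K * T * (V * N₀ ^ (3 / 2 : ℝ))) ^ 2 := by rw [← hsq]; ring

lemma exists_pow_near_cbrt {q W : ℝ} (hq : 1 < q) (hW : 0 ≤ W) :
    ∃ n : ℕ, W < q ^ (3 * n) ∧ q ^ n ≤ q * (1 + W ^ (1 / 3 : ℝ)) := by
  have hroot : 0 ≤ W ^ (1 / 3 : ℝ) := by positivity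
  obtain ⟨n, hn, hn'⟩ := exists_nat_pow_near (x := 1 + W ^ (1 / 3 : ℝ)) (by linarith) hq
  refine ⟨n + 1, ?_, ?_⟩
  · have h1 : W ^ (1 / 3 : ℝ) < q ^ (n + 1) := by linarith
    have h3 := pow_lt_pow_left₀ h1 hroot (n := 3) (by norm_num)
    rw [← Real.rpow_natCast, ← Real.rpow_mul hW, ← pow_mul] at h3
    rw [mul_comm 3]
    simpa using h3
  · rw [pow_succ']
    gcongr

lemma one_le_absNorm {I : Ideal (𝓞 k)} (hI : I ≠ 0) : 1 ≤ Ideal.absNorm I :=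
  Nat.one_le_iff_ne_zero.2 (by rwa [Ne, Ideal.absNorm_eq_zero_iff])

lemma one_lt_absNorm {P : Ideal (𝓞 k)} (hP : Prime P) : 1 < Ideal.absNorm P := by
  have h1 : Ideal.absNorm P ≠ 1 := by
    rw [Ne, Ideal.absNorm_eq_one_iff]; exact (Ideal.isPrime_of_prime hP).ne_top
  have h0 := one_le_absNorm hP.ne_zero
  omega

lemma absNorm_le_of_dvd {I J : Ideal (𝓞 k)} (hJ : J ≠ 0) (h : I ∣ J) :
    Ideal.absNorm I ≤ Ideal.absNorm J :=
  Nat.le_of_dvd (one_le_absNorm hJ) (map_dvd Ideal.absNorm h)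

lemma card_le_of_box {M : Matrix (Fin 3) (Fin 3) (𝓞 k)} (hM : M.IsSymm) (hdet : M.det ≠ 0)
    {r : Fin 3 → InfinitePlace k → ℝ} (hr : ∀ i v, 1 ≤ r i v)
    {ι : Type*} {Y : ι → Fin 3 → 𝓞 k} (hY : IsConicFamily M Y)
    (hbox : ∀ i j, Y i j ∈ box (r j)) (S : Finset ι)
    {P : Ideal (𝓞 k)} (hP : Prime P) (hprim : ∀ i, ∃ j, Y i j ∉ P) :
    (S.card : ℝ) ≤ 4 * Ideal.absNorm P * (36 ^ Fintype.card (InfinitePlace k) *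
        Ideal.absNorm (Ideal.span {(2 : 𝓞 k)})) *
      (1 + (boxNorm (r 0) * boxNorm (r 1) * boxNorm (r 2) *
        (Ideal.absNorm (minorIdeal M) : ℝ) ^ (3 / 2 : ℝ) /
          (Ideal.absNorm (detIdeal M) : ℝ)) ^ (1 / 3 : ℝ)) * (tau (detIdeal M) : ℝ) := by
  have hnonneg : ∀ i, 0 ≤ boxNorm (r i) := fun i ↦
    Finset.prod_nonneg fun v _ ↦ zero_le_one.trans (hr i v)
  have h2 : (2 : 𝓞 k) ≠ 0 := two_ne_zero
  have hT1 : (1 : ℝ) ≤ (Ideal.absNorm (Ideal.span {(2 : 𝓞 k)}) : ℕ) :=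
    Nat.one_le_cast.2 (one_le_absNorm (span_ne_zero h2))
  have hK1 : (1 : ℝ) ≤ 36 ^ Fintype.card (InfinitePlace k) := one_le_pow₀ (by norm_num)
  have hN1 : (1 : ℝ) ≤ (Ideal.absNorm (detIdeal M) : ℕ) :=
    Nat.one_le_cast.2 (one_le_absNorm (span_ne_zero hdet))
  have hN₀1 : (1 : ℝ) ≤ (Ideal.absNorm (minorIdeal M) : ℕ) :=
    Nat.one_le_cast.2 (one_le_absNorm (minors_ne_zero hdet))
  have hq1 : (1 : ℝ) < (Ideal.absNorm P : ℕ) := Nat.one_lt_cast.2 (one_lt_absNorm hP)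
  have hV0 : 0 ≤ boxNorm (r 0) * boxNorm (r 1) * boxNorm (r 2) :=
    mul_nonneg (mul_nonneg (hnonneg 0) (hnonneg 1)) (hnonneg 2)
  have hclose : ∀ n i j l, triple (Y i) (Y j) (Y l) ≠ 0 →
      Ideal.span {M.det} ^ 2 * P ^ (6 * n) ∣
        Ideal.span {triple (Y i) (Y j) (Y l)} ^ 2 * minors M ^ 3 * Ideal.span {2} ^ 2 →
      (Ideal.absNorm P : ℝ) ^ (3 * n) ≤ 36 ^ Fintype.card (InfinitePlace k) *
        (Ideal.absNorm (Ideal.span {(2 : 𝓞 k)}) : ℕ) *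
        (boxNorm (r 0) * boxNorm (r 1) * boxNorm (r 2) *
          ((Ideal.absNorm (minorIdeal M) : ℕ) : ℝ) ^ (3 / 2 : ℝ) /
          ((Ideal.absNorm (detIdeal M) : ℕ) : ℝ)) := by
    intro n i j l hne hdvd
    have hle := absNorm_le_of_dvd (mul_ne_zero (mul_ne_zero (pow_ne_zero _ (span_ne_zero hne))
      (pow_ne_zero _ (minors_ne_zero hdet))) (pow_ne_zero _ (span_ne_zero h2))) hdvd
    simp only [map_mul, map_pow] at hle
    have hle' := (Nat.cast_le (α := ℝ)).2 hle
    push_cast at hle'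
    exact pow_le_of_sq_le (by linarith) (by linarith) (by linarith) (by linarith) hV0
      (Nat.cast_nonneg _) (absNorm_triple_le (hbox i) (hbox j) (hbox l)) hle'
  generalize boxNorm (r 0) * boxNorm (r 1) * boxNorm (r 2) = V at hclose hV0 ⊢
  have hcard := fun n hno ↦ (Nat.cast_le (α := ℝ)).2
    (card_le_of_not_dvd h2 hM hdet hY S hP hprim n hno)
  change ∀ n, _ → _ ≤ ((2 * (tau (detIdeal M) * (2 * Ideal.absNorm P ^ n)) : ℕ) : ℝ) at hcard
  push_cast at hcard
  generalize (Ideal.absNorm P : ℝ) = q at *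
  generalize (Ideal.absNorm (Ideal.span {(2 : 𝓞 k)}) : ℝ) = T at *
  generalize (Ideal.absNorm (minorIdeal M) : ℝ) = N₀ at *
  generalize (Ideal.absNorm (detIdeal M) : ℝ) = N at *
  generalize (36 : ℝ) ^ Fintype.card (InfinitePlace k) = K at *
  have hX0 : 0 ≤ V * N₀ ^ (3 / 2 : ℝ) / N := by positivity
  generalize V * N₀ ^ (3 / 2 : ℝ) / N = X at *
  have hKT : 1 ≤ K * T := one_le_mul_of_one_le_of_one_le hK1 hT1
  -- This n makes `hclose` impossible, while rounding to a power of q costs at most one factor q.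
  obtain ⟨n, hn, hn'⟩ := exists_pow_near_cbrt (W := K * T * X) hq1 (by positivity)
  have hrootle : (K * T * X) ^ (1 / 3 : ℝ) ≤ K * T * X ^ (1 / 3 : ℝ) := by
    rw [Real.mul_rpow (by positivity) hX0]
    gcongr
    exact Real.rpow_le_self_of_one_le hKT (by norm_num)
  have hpow : q ^ n ≤ q * (K * T * (1 + X ^ (1 / 3 : ℝ))) := by
    refine hn'.trans ?_
    gcongr
    rw [mul_add, mul_one]
    gcongr
  calc (S.card : ℝ) ≤ 2 * (tau (detIdeal M) * (2 * q ^ n)) :=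
        hcard n fun i _ j _ l _ hne hdvd ↦ absurd (hclose n i j l hne hdvd) (not_le.2 hn)
    _ ≤ 2 * (tau (detIdeal M) * (2 * (q * (K * T * (1 + X ^ (1 / 3 : ℝ)))))) := by gcongr
    _ = _ := by ring

end NumberField

end ConicCount

/-! ### From projective points to isotropic vectors -/

theorem theorem2p3 {k : Type*} [Field k] [NumberField k]
    (a : ClassGroup (NumberField.RingOfIntegers k) →
      nonZeroDivisors (Ideal (NumberField.RingOfIntegers k)))
    (ha : ConicCount.IsClassRepresentatives a) :
    ∃ C : ℝ, 0 < C ∧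
      ∀ (M : Matrix (Fin 3) (Fin 3) (NumberField.RingOfIntegers k))
        (r : Fin 3 → NumberField.InfinitePlace k → ℝ),
        M.IsSymm → M.det ≠ 0 → (∀ i v, 1 ≤ r i v) →
          (ConicCount.conicPoints a M r).Finite ∧
          ((ConicCount.conicPoints a M r).ncard : ℝ) ≤
            C * (1 + (ConicCount.boxNorm (r 0) * ConicCount.boxNorm (r 1) *
                  ConicCount.boxNorm (r 2) *
                  (Ideal.absNorm (ConicCount.minorIdeal M) : ℝ) ^ (3 / 2 : ℝ) /
                  (Ideal.absNorm (ConicCount.detIdeal M) : ℝ)) ^ (1 / 3 : ℝ)) *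
              (ConicCount.tau (ConicCount.detIdeal M) : ℝ) := by
  open ConicCount in
  obtain ⟨P, hP, hPa⟩ := exists_prime_not_le a
  have hpos : ∀ I : Ideal (𝓞 k), I ≠ 0 → 0 < (Ideal.absNorm I : ℝ) := fun I hI ↦ by
    exact_mod_cast Nat.pos_of_ne_zero (by rwa [Ne, Ideal.absNorm_eq_zero_iff])
  have hP0 := hpos P hP.ne_zero
  have h20 := hpos _ (span_ne_zero (two_ne_zero : (2 : 𝓞 k) ≠ 0))
  -- The 4 is two points per label times the bit at P. P depends only on the chosen ideals, so the
  -- constant is uniform in M and r.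
  refine ⟨4 * Ideal.absNorm P * (36 ^ Fintype.card (InfinitePlace k) *
    Ideal.absNorm (Ideal.span {(2 : 𝓞 k)})), by positivity, fun M r hM hdet hr ↦ ?_⟩
  have hrep : ∀ x : conicPoints a M r, ∃ y : Fin 3 → 𝓞 k,
      (∃ hy : (fun i => (y i : k)) ≠ 0, Projectivization.mk k (fun i => (y i : k)) hy = x.1) ∧
      pairing M y y = 0 ∧ y ∈ primitiveVectors a ∧ ∀ i, y i ∈ box (r i) := by
    rintro ⟨x, y, hy, hyx, hQ, hprim, hbox⟩
    refine ⟨y, ⟨hy, hyx⟩, ?_, hprim, hbox⟩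
    rwa [form_coe, map_eq_zero_iff _ RingOfIntegers.coe_injective] at hQ
  choose Y hmk hiso hprim hbox using hrep
  have hY : IsConicFamily M Y := by
    refine ⟨hiso, fun x x' hne h ↦ hne (Subtype.ext ?_)⟩
    obtain ⟨hy, hyx⟩ := hmk x
    obtain ⟨hy', hyx'⟩ := hmk x'
    rw [← hyx, ← hyx', Projectivization.mk_eq_mk_iff']
    obtain ⟨j, hj⟩ := Function.ne_iff.1 hy'
    simp only [Pi.zero_apply] at hj
    refine ⟨(Y x j : k) / (Y x' j : k), funext fun i ↦ ?_⟩
    have hprop : (Y x i : k) * (Y x' j : k) = (Y x j : k) * (Y x' i : k) := by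
      exact_mod_cast congrArg (algebraMap (𝓞 k) k)
        (proportional_of_pairing_eq_zero hM hdet (hiso x) (hiso x') h i j)
    simp only [Pi.smul_apply, smul_eq_mul]
    field_simp
    rw [← hprop, mul_comm]
  have hfinbox : (Set.univ.pi fun i : Fin 3 ↦ box (r i)).Finite :=
    Set.Finite.pi fun i ↦ finite_box (hr i)
  have hfin : Finite (conicPoints a M r) := by
    have : Finite (Set.univ.pi fun i : Fin 3 ↦ box (r i)) := hfinbox
    refine Finite.of_injective
      (fun x ↦ (⟨Y x, fun i _ ↦ hbox x i⟩ : (Set.univ.pi fun i : Fin 3 ↦ box (r i)))) ?_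
    intro x x' h
    by_contra hne
    have hYY : Y x = Y x' := congrArg Subtype.val h
    exact hY.pairing_ne_zero x x' hne (by rw [← hYY]; exact hiso x)
  refine ⟨hfin, ?_⟩
  have : Fintype (conicPoints a M r) := Fintype.ofFinite _
  have hcard := card_le_of_box hM hdet hr hY hbox Finset.univ hP (fun x ↦ by
    by_contra! hall
    obtain ⟨c, hc⟩ := hprim x
    refine hPa c (hc ▸ Ideal.span_le.2 ?_)
    rintro _ ⟨i, rfl⟩
    exact hall i)
  rwa [Finset.card_univ, ← Nat.card_eq_fintype_card, Nat.card_coe_set_eq] at hcard
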